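/- All rings are associative and unital. For a ring $R$ let $\mathrm{Id}(R)$, $\mathrm{Nil}(R)$ and $U(R)$ denote its sets of idempotents, nilpotents and units. Call $R$ - *D-regularly nil clean* if for each $a\in R$ there is $e\in aRa\cap \mathrm{Id}(R)$ with $a(1-e)\in \mathrm{Nil}(R)$; and *D-regularly nil clean of index at most $k$* (for a fixed integer $k\ge 1$) if for each $a\in R$ there is $e\in aRa\cap \mathrm{Id}(R)$ with $(a(1-e))^k=0$; - *nil-clean* if each $r\in R$ can be written as $r=q+e$ with $q\in \mathrm{Nil}(R)$ and $e\in \mathrm{Id}(R)$; - *strongly clean* if each $r\in R$ can be written as $r=u+e$ with $u\in U(R)$, $e\in \mathrm{Id}(R)$ and $ue=eu$; - *$\pi$-regular* if for each $a\in R$ there is an integer $n\ge 1$ with $a^n\in a^nRa^n$. Then there exists a D-regularly nil clean ring of index at most $4$ which is both nil-clean and strongly clean, but not $\pi$-regular. Specifically, the ring $R=\prod_{n\ge 1}\mathbb{M}_n(\mathbb{Z}/4\mathbb{Z})$ of all sequences of $n\times n$ matrices over $\mathbb{Z}/4\mathbb{Z}$ $(n=1,2,3,\dots)$ has these properties. 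-/

import Mathlib

/-- `R` is D-regularly nil clean: every `a` admits an idempotent `e ∈ aRa` such that
`a(1 - e)` is nilpotent. -/
def IsDRegularlyNilClean (R : Type*) [Ring R] : Prop :=
  ∀ a : R, ∃ e : R, (∃ r : R, e = a * r * a) ∧ IsIdempotentElem e ∧ IsNilpotent (a * (1 - e))

/-- `R` is D-regularly nil clean of index at most `k`, where `k` is a positive integer: every `a`
admits an idempotent `e ∈ aRa` such that `(a(1 - e))^k = 0`. -/
def IsDRegularlyNilCleanOfIndexAtMost (R : Type*) [Ring R] (k : ℕ) : Prop :=
  0 < k ∧ ∀ a : R, ∃ e : R,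
    (∃ r : R, e = a * r * a) ∧ IsIdempotentElem e ∧ (a * (1 - e)) ^ k = 0

/-- `R` is nil-clean: every element is the sum of a nilpotent and an idempotent. -/
def IsNilCleanRing (R : Type*) [Ring R] : Prop :=
  ∀ r : R, ∃ q e : R, IsNilpotent q ∧ IsIdempotentElem e ∧ r = q + e

/-- `R` is strongly clean: every element is the sum of a unit and an idempotent that commute. -/
def IsStronglyCleanRing (R : Type*) [Ring R] : Prop :=
  ∀ r : R, ∃ u e : R, IsUnit u ∧ IsIdempotentElem e ∧ r = u + e ∧ u * e = e * u

/-- `R` is `π`-regular: every `a` has a power `a ^ n` with `n ≥ 1` and `a ^ n ∈ a ^ n R a ^ n`. -/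
def IsPiRegularRing (R : Type*) [Ring R] : Prop :=
  ∀ a : R, ∃ n : ℕ, 1 ≤ n ∧ ∃ b : R, a ^ n = a ^ n * b * a ^ n

/-- The direct product of the rings of `n × n` matrices over `ℤ/4ℤ`, over all `n ≥ 1`. -/
abbrev ProdMatrixZModFour : Type :=
  ∀ n : ℕ+, Matrix (Fin (n : ℕ)) (Fin (n : ℕ)) (ZMod 4)

/-!
Reduction modulo 2 maps `∏ₙ Mₙ(ℤ/4)` onto `∏ₙ Mₙ(𝔽₂)`, and any two elements of its kernel multiply
to zero. Nilpotency in an infinite product demands a bound on the index that is uniform over the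
factors; D-regularity and nil-cleanness are proved over `𝔽₂` with such a bound and then lifted, which
doubles the index.

*D-regularity.* A matrix ring over a field is von Neumann regular. If `r` satisfies
`a² r a² = a²` and `r a² r = r`, then `e = a r a` is idempotent and `a (1 - e) a = 0`, so
`(a (1 - e))² = 0`. After lifting `r`, the polynomial `3x² - 2x³` turns `x = a r a` into an
idempotent that still lies in `a R a`; the index becomes 4.

*Nil-cleanness.* Every endomorphism `a` of a finite-dimensional `𝔽₂`-space is the sum of an
idempotent and an element whose sixth power vanishes. If `p` is an idempotent such that the
corners `p a p - p` and `(1 - p) a (1 - p)` have zero cube, then `e = p + (1 - p) a p` is such an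
idempotent (`HasNilCleanDecomposition.of_corners`). By the structure theorem for torsion modules
over `𝔽₂[X]` it is enough to treat a cyclic vector `x`. For scalars `d 0, d 1, …` in `𝔽₂`, the
vectors `v 0 = x`, `v (k + 1) = a (v k) - d k • v k` form a basis, in which `a` is upper Hessenberg
with diagonal `d`, apart from the last column. Take `p = diag d` with `d` alternating from index 1
on; both corners then act by zero on `v i` for `0 < i < n - 1`. The entry `d 0` is chosen so that
`∑ d i` is the trace of `a`, so that the last diagonal entry is `d (n - 1)` as well, and the cubes of
both corners vanish (`corner_pow_three_eq_zero`). In dimension 2 the sequence may fail to alternate;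
then `(a - 1)²` is a scalar, and `a` or `a - 1` has square zero.

*Strong cleanness.* Each factor is finite, so `a` has an idempotent power `f = a ^ k` with `k ≥ 1`.
Then `a - (1 - f)` is a unit: it is `a` on the corner of `f`, and `a - 1` with `a ^ k = 0` on the
complementary corner.

*Failure of `π`-regularity.* The shift of size `m + 1` whose first weight is 2 and whose other
weights are 1 has `m`-th power with the single nonzero entry 2, and `2 b 2 = 0 ≠ 2` in `ℤ/4`. The
element having such a shift in each factor has no regular power.
-/

/-! ### Sums of an idempotent and a nilpotent of bounded index -/

/-- The element `a` is the sum of an idempotent and an element whose `k`-th power is zero. The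
exponent is part of the data because nilpotency in an infinite product needs a uniform bound. -/
def HasNilCleanDecomposition {R : Type*} [Ring R] (k : ℕ) (a : R) : Prop :=
  ∃ e q : R, IsIdempotentElem e ∧ q ^ k = 0 ∧ a = e + q

namespace HasNilCleanDecomposition

theorem map {R S : Type*} [Ring R] [Ring S] {k : ℕ} {a : R}
    (h : HasNilCleanDecomposition k a) (f : R →+* S) : HasNilCleanDecomposition k (f a) := by
  obtain ⟨e, q, he, hq, rfl⟩ := h
  exact ⟨f e, f q, he.map f, by rw [← map_pow, hq, map_zero], map_add f e q⟩

theorem pi {ι : Type*} {R : ι → Type*} [∀ i, Ring (R i)] {k : ℕ} {a : ∀ i, R i}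
    (h : ∀ i, HasNilCleanDecomposition k (a i)) : HasNilCleanDecomposition k a := by
  choose e q he hq ha using h
  exact ⟨e, q, funext he, funext hq, funext ha⟩

/-- If the diagonal Peirce blocks of `a` are unipotent and nilpotent, then `a` has a nil-clean
decomposition: the nilpotent summand can be made block triangular. -/
theorem of_corners {R : Type*} [Ring R] {k : ℕ} (hk : k ≠ 0) {a p : R} (hp : IsIdempotentElem p)
    (h₁ : (p * a * p - p) ^ k = 0) (h₂ : ((1 - p) * a * (1 - p)) ^ k = 0) :
    HasNilCleanDecomposition (k + k) a := by
  have hp' : p * p = p := hp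
  have hpl : ∀ x, p * (p * x) = p * x := fun x => by rw [← mul_assoc, hp']
  -- In Peirce blocks `a = [[1 + s, b], [c, t]]`, `e = [[1, 0], [c, 0]]`, `q = [[s, b], [0, t]]`.
  set e := p + (1 - p) * a * p with he
  set q := a - e with hq
  set s := p * a * p - p with hs
  set t := (1 - p) * a * (1 - p) with ht
  have hqp : q * p = s := by
    simp only [hq, he, hs, sub_mul, add_mul, one_mul, mul_assoc, hp']
    abel
  have hps : p * s = s := by simp only [hs, mul_sub, mul_assoc, hpl, hp']
  have hpq : (1 - p) * q = t := by
    simp only [hq, he, ht, sub_mul, mul_add, mul_sub, one_mul, mul_one, mul_assoc, hpl, hp']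
    abel
  have htp : t * (1 - p) = t := by
    simp only [ht, mul_assoc, hp.one_sub.eq]
  have hqs : ∀ m, q ^ (m + 1) * p = s ^ (m + 1) := by
    have hs2 : q * s = s * s := by rw [← hps, ← mul_assoc, hqp, hps]
    intro m
    induction m with
    | zero => simpa using hqp
    | succ m ih => rw [pow_succ', mul_assoc, ih, pow_succ' s m, ← mul_assoc, hs2, mul_assoc,
        ← pow_succ', ← pow_succ']
  have hqt : ∀ m, (1 - p) * q ^ (m + 1) = t ^ (m + 1) := by
    have ht2 : t * q = t * t := by rw [← htp, mul_assoc, hpq, htp]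
    intro m
    induction m with
    | zero => simpa using hpq
    | succ m ih => rw [pow_succ, ← mul_assoc, ih, pow_succ t m, mul_assoc, ht2, ← mul_assoc,
        ← pow_succ, ← pow_succ]
  obtain ⟨m, rfl⟩ := Nat.exists_eq_succ_of_ne_zero hk
  refine ⟨e, q, ?_, ?_, by rw [hq]; abel⟩
  · simp only [IsIdempotentElem, he, add_mul, mul_add, mul_sub, sub_mul, one_mul, mul_assoc,
      hpl, hp']
    abel
  · calc q ^ (m.succ + m.succ) = q ^ (m + 1) * p * q ^ (m + 1)
          + q ^ (m + 1) * ((1 - p) * q ^ (m + 1)) := by rw [pow_add]; noncomm_ring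
      _ = 0 := by rw [hqs, hqt, h₁, h₂, zero_mul, mul_zero, add_zero]

end HasNilCleanDecomposition


/-! ### Endomorphisms in Hessenberg form -/

section Hessenberg

open Module

/-- Let `a` be Hessenberg with idempotent diagonal entries `d i` in the basis `v 0, …, v (n - 1)`,
and let `p` be the diagonal projection `diag d`. The corner `p a p - p` sends `v i` to
`d i * d (i + 1) • v (i + 1)` for `i + 1 < n`, and the last vector into the span of the others.
If `d` has no two consecutive ones except possibly at the very start, this map has zero cube. In
dimension 2 the second basis vector is also the last, so there the exception is not allowed. -/
theorem corner_pow_three_eq_zero {F V : Type*} [Field F] [AddCommGroup V] [Module F V] {n : ℕ}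
    (b : Basis (Fin n) F V) {v : ℕ → V} (hv : ∀ i : Fin n, b i = v i) {d : ℕ → F}
    (hd : ∀ i, d i * d i = d i) {a p : End F V} (hp : ∀ i, i < n → p (v i) = d i • v i)
    (hstep : ∀ i, i + 1 < n → a (v i) = v (i + 1) + d i • v i)
    (hlast : ∀ i, i + 1 = n → a (v i) - d i • v i ∈ Submodule.span F (v '' {j | j + 1 < n}))
    (halt : ∀ i, 0 < i ∨ n = 2 → d i * d (i + 1) = 0) :
    (p * a * p - p) ^ 3 = 0 := by
  set N := p * a * p - p with hN
  have hNv : ∀ i, i < n → N (v i) = d i • p (a (v i) - d i • v i) := by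
    intro i hi
    simp only [hN, LinearMap.sub_apply, Module.End.mul_apply, hp i hi, map_sub, map_smul,
      smul_sub, smul_smul, hd]
  have hNstep : ∀ i, i + 1 < n → N (v i) = (d i * d (i + 1)) • v (i + 1) := by
    intro i hi
    rw [hNv i (by omega), hstep i hi, add_sub_cancel_right, hp _ hi, smul_smul]
  -- `N` can be nonzero on a vector other than the last only at `v 0`, whose image is killed by `N`.
  have hN2 : Submodule.span F (v '' {j | j + 1 < n}) ≤ LinearMap.ker (N ^ 2) := by
    rw [Submodule.span_le]
    rintro _ ⟨i, hi, rfl⟩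
    simp only [Set.mem_ofPred_eq] at hi
    simp only [SetLike.mem_coe, LinearMap.mem_ker, pow_two, Module.End.mul_apply]
    rw [hNstep i hi, map_smul]
    by_cases h : 0 < i ∨ n = 2
    · rw [halt i h, zero_smul]
    · rw [hNstep (i + 1) (by omega), halt (i + 1) (by omega), zero_smul, smul_zero]
  have hpL : Submodule.span F (v '' {j | j + 1 < n}) ≤
      (Submodule.span F (v '' {j | j + 1 < n})).comap p := by
    rw [Submodule.span_le]
    rintro _ ⟨i, hi, rfl⟩
    simp only [Set.mem_ofPred_eq] at hi
    simp only [SetLike.mem_coe, Submodule.mem_comap]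
    rw [hp i (by omega)]
    exact Submodule.smul_mem _ _ (Submodule.subset_span ⟨i, hi, rfl⟩)
  refine b.ext fun i => ?_
  rw [hv, LinearMap.zero_apply, pow_succ, Module.End.mul_apply]
  by_cases hi : (i : ℕ) + 1 < n
  · have := hN2 (Submodule.subset_span ⟨i, hi, rfl⟩)
    rw [LinearMap.mem_ker] at this
    rw [← Module.End.mul_apply, ← pow_succ, pow_succ', Module.End.mul_apply, this, map_zero]
  · rw [hNv i i.2]
    exact hN2 (Submodule.smul_mem _ _ (hpL (hlast i (by omega))))

/-- The Newton-type sequence `x`, `(a - d 0) x`, `(a - d 1) (a - d 0) x`, … attached to an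
endomorphism `a`, scalars `d` and a starting vector `x`. -/
def newtonSeq {F V : Type*} [Field F] [AddCommGroup V] [Module F V] (a : End F V) (d : ℕ → F)
    (x : V) : ℕ → V
  | 0 => x
  | k + 1 => a (newtonSeq a d x k) - d k • newtonSeq a d x k

theorem pow_apply_mem_span_newtonSeq {F V : Type*} [Field F] [AddCommGroup V] [Module F V]
    (a : End F V) (d : ℕ → F) (x : V) (k : ℕ) :
    (a ^ k) x ∈ Submodule.span F (newtonSeq a d x '' Set.Iic k) := by
  induction k with
  | zero => exact Submodule.subset_span ⟨0, by simp, rfl⟩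
  | succ k ih =>
    rw [pow_succ', Module.End.mul_apply]
    suffices h : Submodule.span F (newtonSeq a d x '' Set.Iic k) ≤
        (Submodule.span F (newtonSeq a d x '' Set.Iic (k + 1))).comap a from h ih
    rw [Submodule.span_le]
    rintro _ ⟨i, hi, rfl⟩
    have hi' : i ≤ k := hi
    have : a (newtonSeq a d x i) = newtonSeq a d x (i + 1) + d i • newtonSeq a d x i := by
      simp [newtonSeq]
    simp only [SetLike.mem_coe, Submodule.mem_comap, this]
    exact add_mem (Submodule.subset_span ⟨i + 1, Nat.succ_le_succ hi', rfl⟩)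
      (Submodule.smul_mem _ _ (Submodule.subset_span ⟨i, Nat.le_succ_of_le hi', rfl⟩))

theorem exists_basis_newtonSeq {F V : Type*} [Field F] [AddCommGroup V] [Module F V]
    {a : End F V} {x : V} {n : ℕ} (hn : finrank F V = n)
    (hx : ⊤ ≤ Submodule.span F (Set.range fun i : Fin n => (a ^ (i : ℕ)) x)) (d : ℕ → F) :
    ∃ b : Basis (Fin n) F V, ∀ i : Fin n, b i = newtonSeq a d x i := by
  refine ⟨basisOfTopLeSpanOfCardEqFinrank (fun i : Fin n => newtonSeq a d x i) ?_ (by simp [hn]),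
    fun i => by rw [coe_basisOfTopLeSpanOfCardEqFinrank]⟩
  refine hx.trans (Submodule.span_le.2 ?_)
  rintro _ ⟨i, rfl⟩
  refine Submodule.span_mono ?_ (pow_apply_mem_span_newtonSeq a d x i)
  rintro _ ⟨j, hj, rfl⟩
  exact ⟨⟨j, lt_of_le_of_lt hj i.2⟩, rfl⟩

/-- In the basis `newtonSeq a d x`, all diagonal entries of `a` but the last are the `d i`. If the
trace of `a` is the sum of the `d i`, then so is the last one. -/
theorem newtonSeq_last_sub_mem {F V : Type*} [Field F] [AddCommGroup V] [Module F V]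
    {a : End F V} {x : V} {n : ℕ} {d : ℕ → F} (b : Basis (Fin n) F V)
    (hb : ∀ i : Fin n, b i = newtonSeq a d x i)
    (htr : LinearMap.trace F V a = ∑ i ∈ Finset.range n, d i) (i : ℕ) (hi : i + 1 = n) :
    a (newtonSeq a d x i) - d i • newtonSeq a d x i ∈
      Submodule.span F (newtonSeq a d x '' {j | j + 1 < n}) := by
  subst hi
  have hcoef : b.repr (a (b (Fin.last i)) - d i • b (Fin.last i)) (Fin.last i) = 0 := by
    rw [LinearMap.trace_eq_matrix_trace F b, Matrix.trace, Fin.sum_univ_castSucc,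
      Finset.sum_range_succ, ← Fin.sum_univ_eq_sum_range] at htr
    have : ∀ j : Fin i, (LinearMap.toMatrix b b a).diag j.castSucc = d j := by
      intro j
      have h1 : a (b j.castSucc) = b j.succ + d j • b j.castSucc := by
        simp [hb, newtonSeq]
      rw [Matrix.diag_apply, LinearMap.toMatrix_apply, h1]
      simp [Fin.ext_iff]
    simp only [this, add_right_inj, Matrix.diag_apply, LinearMap.toMatrix_apply] at htr
    simp [htr]
  have hlast : b (Fin.last i) = newtonSeq a d x i := by simp [hb]
  rw [← hlast, ← b.sum_repr (a (b (Fin.last i)) - d i • b (Fin.last i)), Fin.sum_univ_castSucc,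
    hcoef, zero_smul, add_zero]
  refine Submodule.sum_mem _ fun j _ => Submodule.smul_mem _ _ (Submodule.subset_span ?_)
  exact ⟨j, by simp, by simp [hb]⟩

/-- A Hessenberg endomorphism over `𝔽₂` with an alternating diagonal, where the first two entries
may coincide unless the dimension is 2, has a nil-clean decomposition of exponent 6. -/
theorem hasNilCleanDecomposition_of_basis {V : Type*} [AddCommGroup V]
    [Module (ZMod 2) V] {n : ℕ} {v : ℕ → V} {d : ℕ → ZMod 2} {a : End (ZMod 2) V}
    (b : Basis (Fin n) (ZMod 2) V) (hv : ∀ i : Fin n, b i = v i)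
    (hstep : ∀ i, i + 1 < n → a (v i) = v (i + 1) + d i • v i)
    (hlast : ∀ i, i + 1 = n →
      a (v i) - d i • v i ∈ Submodule.span (ZMod 2) (v '' {j | j + 1 < n}))
    (halt : ∀ i, 0 < i ∨ n = 2 → d i + d (i + 1) = 1) :
    HasNilCleanDecomposition 6 a := by
  have hF : ∀ c : ZMod 2, c * c = c := by decide
  have hF' : ∀ c c' : ZMod 2, c + c' = 1 → c * c' = 0 := by decide
  have hF'' : ∀ c c' : ZMod 2, c + c' = 1 → (1 - c) * (1 - c') = 0 := by decide
  have h2 : ∀ y : V, y + y = 0 := fun y => by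
    rw [← two_smul (ZMod 2) y, show (2 : ZMod 2) = 0 from rfl, zero_smul]
  have hneg : ∀ y : V, -y = y := fun y => neg_eq_of_add_eq_zero_left (h2 y)
  have hEneg : ∀ f : End (ZMod 2) V, -f = f := fun f => LinearMap.ext fun y => hneg (f y)
  set p : End (ZMod 2) V := b.constr (ZMod 2) fun i => d i • b i with hp
  have hpv : ∀ i, i < n → p (v i) = d i • v i := by
    intro i hi
    rw [← hv ⟨i, hi⟩, hp, b.constr_basis]
  have hpp : IsIdempotentElem p := b.ext fun i => by
    rw [Module.End.mul_apply, hv, hpv i i.2, map_smul, hpv i i.2, smul_smul, hF]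
  refine .of_corners (k := 3) (by norm_num) hpp
    (corner_pow_three_eq_zero b hv (fun i => hF _) hpv hstep hlast fun i hi => hF' _ _ (halt i hi))
    ?_
  -- In characteristic 2, `(1 - p) a (1 - p) = p' a' p' - p'` for `a' = a + 1` and `p' = 1 - p`.
  have key := corner_pow_three_eq_zero (a := a + 1) (p := 1 - p) (d := fun i => 1 - d i) b hv
    (fun i => hF _) (fun i hi => by simp [hpv i hi, sub_smul])
    (fun i hi => by
      rw [LinearMap.add_apply, hstep i hi, sub_smul, one_smul, Module.End.one_apply, sub_eq_add_neg,
        hneg]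
      abel)
    (fun i hi => by
      have := hlast i hi
      rw [LinearMap.add_apply, sub_smul, one_smul, Module.End.one_apply]
      rwa [show a (v i) + v i - (v i - d i • v i) = a (v i) + d i • v i by abel,
        ← hneg (d i • v i), ← sub_eq_add_neg])
    (fun i hi => hF'' _ _ (halt i hi))
  rwa [mul_add, mul_one, add_mul, hpp.one_sub.eq, add_sub_cancel_right] at key

theorem hasNilCleanDecomposition_of_cyclic {V : Type*} [AddCommGroup V] [Module (ZMod 2) V]
    {a : End (ZMod 2) V} {x : V} {n : ℕ} (hn : finrank (ZMod 2) V = n)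
    (hx : ⊤ ≤ Submodule.span (ZMod 2) (Set.range fun i : Fin n => (a ^ (i : ℕ)) x)) :
    HasNilCleanDecomposition 6 a := by
  have hF : ∀ c : ZMod 2, c = 0 ∨ c = 1 := by decide
  -- The diagonal alternates from index 1 on, and its first entry corrects the trace.
  set δ : ZMod 2 :=
    LinearMap.trace (ZMod 2) V a - ∑ i ∈ Finset.range (n - 1), ((i + 1 : ℕ) : ZMod 2) with hδ
  set d : ℕ → ZMod 2 := fun i => if i = 0 then δ else (i : ZMod 2) with hd
  obtain ⟨b, hb⟩ := exists_basis_newtonSeq hn hx d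
  have htr : LinearMap.trace (ZMod 2) V a = ∑ i ∈ Finset.range n, d i := by
    rcases n with _ | m
    · have : Subsingleton V := b.repr.toEquiv.subsingleton
      rw [Subsingleton.elim a 0]
      simp
    · simp [Finset.sum_range_succ', hd, hδ]
  have hlast := newtonSeq_last_sub_mem b hb htr
  have hstep : ∀ i, i + 1 < n →
      a (newtonSeq a d x i) = newtonSeq a d x (i + 1) + d i • newtonSeq a d x i :=
    fun i _ => by simp [newtonSeq]
  have h1 : ∀ i : ℕ, (i : ZMod 2) + ((i + 1 : ℕ) : ZMod 2) = 1 := by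
    intro i
    have : ∀ c : ZMod 2, c + (c + 1) = 1 := by decide
    simpa using this i
  by_cases h : n = 2 ∧ δ = 1
  · obtain ⟨rfl, hδ1⟩ := h
    have hd0 : d 0 = 1 := by simp [hd, hδ1]
    have hd1 : d 1 = 1 := by simp [hd]
    -- Here the diagonal is `(1, 1)`; the last column then shows that `(a - 1) ^ 2` is a scalar.
    have hmem := hlast 1 rfl
    have hset : {j : ℕ | j + 1 < 2} = {0} := by ext j; simp
    rw [hset, Set.image_singleton, Submodule.mem_span_singleton] at hmem
    obtain ⟨α, hα⟩ := hmem
    have hv0 : newtonSeq a d x 0 = x := rfl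
    have hv1 : newtonSeq a d x 1 = (a - 1) x := by simp [newtonSeq, hd0]
    have hx2 : ((a - 1) ^ 2 : End (ZMod 2) V) x = α • x := by
      have hα' : α • x = a (newtonSeq a d x 1) - d 1 • newtonSeq a d x 1 := hα
      rw [hα', hv1, hd1, pow_two]
      simp
    have hsq : (a - 1) ^ 2 = α • (1 : End (ZMod 2) V) := by
      refine b.ext fun i => ?_
      rw [hb]
      fin_cases i
      · simpa [hv0] using hx2
      · change ((a - 1) ^ 2 : End (ZMod 2) V) (newtonSeq a d x 1) = α • newtonSeq a d x 1
        rw [hv1, ← Module.End.mul_apply, ← pow_succ, pow_succ', Module.End.mul_apply, hx2, map_smul]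
    rcases hF α with rfl | rfl
    · exact ⟨1, a - 1, .one, by rw [show 6 = 2 + 4 from rfl, pow_add, hsq, zero_smul, zero_mul],
        by abel⟩
    · have ha : a ^ 2 = 0 := by
        have h4 : a ^ 2 = (a - 1) ^ 2 - 1 + (a + a) := by noncomm_ring
        have h5 : a + a = (2 : ZMod 2) • a := (two_smul _ a).symm
        rw [h4, h5, hsq, show (2 : ZMod 2) = 0 from rfl]
        simp
      exact ⟨0, a, .zero, by rw [show 6 = 2 + 4 from rfl, pow_add, ha, zero_mul], by simp⟩
  · refine hasNilCleanDecomposition_of_basis b hb hstep hlast fun i hi => ?_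
    rcases Nat.eq_zero_or_pos i with rfl | hi0
    · have hδ0 : δ = 0 := (hF δ).resolve_right fun h' => h ⟨by omega, h'⟩
      simp [hd, hδ0]
    · simpa [hd, hi0.ne'] using h1 i

end Hessenberg

/-! ### Matrices over `𝔽₂` -/

section MatrixModTwo

open Module Polynomial DirectSum

/-- The ring homomorphism from families of endomorphisms to endomorphisms of the direct sum. -/
def directSumEnd {F ι : Type*} [CommRing F] (M : ι → Type*) [∀ i, AddCommGroup (M i)]
    [∀ i, Module F (M i)] : (∀ i, End F (M i)) →+* End F (⨁ i, M i) where
  toFun f := DirectSum.lmap f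
  map_one' := DirectSum.lmap_id
  map_mul' f g := DirectSum.lmap_comp g f
  map_zero' := by ext; rfl
  map_add' f g := by ext; rfl

theorem hasNilCleanDecomposition_lsmul_X (f : (ZMod 2)[X]) (hf : f ≠ 0) :
    HasNilCleanDecomposition 6
      (Algebra.lsmul (ZMod 2) (ZMod 2) ((ZMod 2)[X] ⧸ (ZMod 2)[X] ∙ f) (X : (ZMod 2)[X])) := by
  -- `AdjoinRoot f` is by definition the quotient at hand, with `1, X, X ^ 2, …` as a basis.
  let pb := AdjoinRoot.powerBasis hf
  refine hasNilCleanDecomposition_of_cyclic (x := Submodule.Quotient.mk 1) (n := pb.dim)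
    pb.finrank ?_
  intro y _
  refine Submodule.span_mono ?_ (pb.basis.mem_span y)
  rintro _ ⟨i, rfl⟩
  have h₁ : (Algebra.lsmul (ZMod 2) (ZMod 2) ((ZMod 2)[X] ⧸ (ZMod 2)[X] ∙ f) (X : (ZMod 2)[X]) ^
      (i : ℕ)) (Submodule.Quotient.mk 1) = Submodule.Quotient.mk (X ^ (i : ℕ)) := by
    rw [← map_pow, Algebra.lsmul_coe]
    beta_reduce
    rw [← Submodule.Quotient.mk_smul, smul_eq_mul, mul_one]
  have h₂ : pb.basis i = AdjoinRoot.mk f (X ^ (i : ℕ)) := by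
    rw [pb.basis_eq_pow, map_pow, AdjoinRoot.mk_X, AdjoinRoot.powerBasis_gen]
  exact ⟨i, h₁.trans h₂.symm⟩

theorem hasNilCleanDecomposition_end {V : Type} [AddCommGroup V] [Module (ZMod 2) V]
    [FiniteDimensional (ZMod 2) V] (a : End (ZMod 2) V) : HasNilCleanDecomposition 6 a := by
  obtain ⟨ι, _, p, hp, e, ⟨φ⟩⟩ := Module.equiv_directSum_of_isTorsion
    (Module.AEval.isTorsion_of_finiteDimensional (ZMod 2) V a)
  let ψ := AEval'.of a ≪≫ₗ φ.restrictScalars (ZMod 2)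
  have h := (HasNilCleanDecomposition.pi fun i =>
    hasNilCleanDecomposition_lsmul_X (p i ^ e i) (pow_ne_zero _ (hp i).ne_zero)).map
      (directSumEnd (F := ZMod 2) _)
  have h' := h.map (ψ.symm.conjRingEquiv : _ →+* End (ZMod 2) V)
  convert h' using 1
  ext v
  have hX : ψ (a v) = (X : (ZMod 2)[X]) • ψ v := by
    change φ (AEval'.of a (a v)) = X • φ (AEval'.of a v)
    rw [← AEval'.X_smul_of, map_smul]
  change a v = ψ.symm _
  rw [LinearEquiv.eq_symm_apply, hX]
  rfl

theorem Matrix.hasNilCleanDecomposition {n : Type} [Fintype n] [DecidableEq n]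
    (A : Matrix n n (ZMod 2)) : HasNilCleanDecomposition 6 A := by
  simpa using (hasNilCleanDecomposition_end (Matrix.toLinAlgEquiv' A)).map
    (Matrix.toLinAlgEquiv'.symm : _ ≃ₐ[ZMod 2] Matrix n n (ZMod 2)).toRingEquiv.toRingHom

end MatrixModTwo

/-! ### Von Neumann regularity of matrix rings over fields -/

/-- The endomorphism ring of a vector space is von Neumann regular: extend a section of `f` from its
range to the whole space. -/
theorem Module.End.exists_mul_mul_eq_self {F V : Type*} [Field F] [AddCommGroup V] [Module F V]
    (f : Module.End F V) : ∃ g : Module.End F V, f * g * f = f := by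
  obtain ⟨s, hs⟩ := f.rangeRestrict.exists_rightInverse_of_surjective f.range_rangeRestrict
  obtain ⟨g, hg⟩ := LinearMap.exists_extend s
  refine ⟨g, LinearMap.ext fun x => ?_⟩
  have h1 := LinearMap.congr_fun hg ⟨f x, x, rfl⟩
  have h2 := LinearMap.congr_fun hs ⟨f x, x, rfl⟩
  have h3 := congrArg Subtype.val h2
  simp only [LinearMap.comp_apply, Submodule.subtype_apply] at h1
  simpa [Module.End.mul_apply, h1] using h3

theorem Matrix.exists_mul_mul_eq_self {F n : Type*} [Field F] [Fintype n] [DecidableEq n]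
    (A : Matrix n n F) :
    ∃ B : Matrix n n F, A * B * A = A := by
  obtain ⟨g, hg⟩ := Module.End.exists_mul_mul_eq_self (Matrix.toLinAlgEquiv' A)
  obtain ⟨B, rfl⟩ := Matrix.toLinAlgEquiv'.surjective g
  exact ⟨B, Matrix.toLinAlgEquiv'.injective (by simpa using hg)⟩

/-! ### Finite rings are strongly clean -/

theorem exists_isIdempotentElem_pow {M : Type*} [Monoid M] [Finite M] (a : M) :
    ∃ k, k ≠ 0 ∧ IsIdempotentElem (a ^ k) := by
  obtain ⟨i, j, hij, h⟩ : ∃ i j : ℕ, i < j ∧ a ^ i = a ^ j := by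
    obtain ⟨i, j, hne, h⟩ := Finite.exists_ne_map_eq_of_infinite fun n : ℕ => a ^ n
    rcases hne.lt_or_gt with h' | h'
    exacts [⟨i, j, h', h⟩, ⟨j, i, h', h.symm⟩]
  obtain ⟨p, rfl⟩ := Nat.exists_eq_add_of_lt hij
  have hper : ∀ m, i ≤ m → ∀ t, a ^ (m + t * (p + 1)) = a ^ m := by
    intro m hm t
    induction t with
    | zero => simp
    | succ t ih =>
      obtain ⟨c, rfl⟩ := Nat.exists_eq_add_of_le hm
      rw [show i + c + (t + 1) * (p + 1) = (i + p + 1) + (c + t * (p + 1)) by ring, pow_add, ← h,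
        ← pow_add, ← add_assoc, ih]
  refine ⟨(i + 1) * (p + 1), by positivity, ?_⟩
  rw [IsIdempotentElem, ← pow_add]
  exact hper _ (by nlinarith) _

theorem Finite.exists_isUnit_add_isIdempotentElem {R : Type*} [Ring R] [Finite R] (a : R) :
    ∃ u e : R, IsUnit u ∧ IsIdempotentElem e ∧ a = u + e ∧ u * e = e * u := by
  obtain ⟨k, hk, hf⟩ := exists_isIdempotentElem_pow a
  obtain ⟨m, rfl⟩ := Nat.exists_eq_succ_of_ne_zero hk
  set f := a ^ m.succ with hfdef
  set g := ∑ i ∈ Finset.range m.succ, a ^ i with hg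
  have hff : f * f = f := hf
  have hag : (a - 1) * g = f - 1 := mul_geom_sum a m.succ
  have hga : g * (a - 1) = f - 1 := geom_sum_mul a m.succ
  have haf : Commute a f := Commute.self_pow a _
  have hgf : Commute g f := Commute.sum_left _ _ _ fun i _ => (Commute.refl a).pow_pow _ _
  have hbf : Commute (a ^ m) f := (Commute.refl a).pow_pow _ _
  have hba : a ^ m * a = f := (pow_succ a m).symm
  have hab : a * a ^ m = f := (pow_succ' a m).symm
  -- A product of block-diagonal elements is computed blockwise; this gives both one-sided inverses.
  have key : ∀ x y c h : R, x * y = f → (c * h = f - 1) → Commute y f → Commute h f →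
      (x * f + c * (1 - f)) * (y * f - h * (1 - f)) = 1 := by
    intro x y c h hxy hch hy hh
    have e1 : f * (y * f) = y * f := by rw [← mul_assoc, ← hy.eq, mul_assoc, hff]
    have e2 : f * (h * (1 - f)) = 0 := by rw [← mul_assoc, ← hh.eq, mul_assoc, hf.mul_one_sub_self,
      mul_zero]
    calc (x * f + c * (1 - f)) * (y * f - h * (1 - f))
        = x * (f * (y * f)) - x * (f * (h * (1 - f))) + c * (y * f) - c * (f * (y * f))
          - c * h * (1 - f) + c * (f * (h * (1 - f))) := by noncomm_ring
      _ = x * y * f - c * h * (1 - f) := by rw [e1, e2]; noncomm_ring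
      _ = f * f - (f * 1 - f * f - 1 * 1 + f) := by rw [hxy, hch]; noncomm_ring
      _ = 1 := by rw [hff]; noncomm_ring
  refine ⟨a * f + (a - 1) * (1 - f), 1 - f, ?_, hf.one_sub, by noncomm_ring, ?_⟩
  · refine ⟨⟨_, a ^ m * f - g * (1 - f), key _ _ _ _ hab hag hbf hgf, ?_⟩, rfl⟩
    have := key (a ^ m) a (-g) (-(a - 1)) hba (by rw [neg_mul_neg, hga]) haf
      ((haf.sub_left (Commute.one_left f)).neg_left)
    rwa [neg_mul, neg_mul, ← sub_eq_add_neg, sub_neg_eq_add] at this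
  · have h1 : Commute a (1 - f) := (Commute.one_right a).sub_right haf
    have h2 : Commute f (1 - f) := (Commute.one_right f).sub_right (Commute.refl f)
    exact (((h1.mul_left h2).add_left ((h1.sub_left (Commute.one_left _)).mul_left
      (Commute.refl _)))).eq

/-! ### Lifting along a surjection whose kernel has square zero -/

theorem HasNilCleanDecomposition.of_map {R S : Type*} [Ring R] [Ring S] {f : R →+* S}
    (hf : Function.Surjective f) (hker : ∀ x y, f x = 0 → f y = 0 → x * y = 0) {k : ℕ} {a : R}
    (h : HasNilCleanDecomposition k (f a)) : HasNilCleanDecomposition (k + k) a := by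
  obtain ⟨e, q, he, hq, hfa⟩ := h
  obtain ⟨e', he', rfl⟩ := exists_isIdempotentElem_eq_of_ker_isNilpotent f
    (fun x hx => ⟨2, by rw [pow_two]; exact hker x x hx hx⟩) e (hf e) he
  have h0 : f ((a - e') ^ k) = 0 := by rw [map_pow, map_sub, hfa, add_sub_cancel_left, hq]
  exact ⟨e', a - e', he', by rw [pow_add]; exact hker _ _ h0 h0, by abel⟩

/-- If `S` is von Neumann regular and `R → S` is surjective with square-zero kernel, then `R` is
D-regularly nil clean of index at most 4. -/
theorem exists_isIdempotentElem_mul_one_sub_pow_four_eq_zero {R S : Type*} [Ring R] [Ring S]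
    {f : R →+* S} (hf : Function.Surjective f) (hker : ∀ x y, f x = 0 → f y = 0 → x * y = 0)
    (hS : ∀ s : S, ∃ t, s * t * s = s) (a : R) :
    ∃ e : R, (∃ r : R, e = a * r * a) ∧ IsIdempotentElem e ∧ (a * (1 - e)) ^ 4 = 0 := by
  obtain ⟨t, ht⟩ := hS (f a * f a)
  obtain ⟨r₀, rfl⟩ := hf t
  -- This modification of `r₀` is a reflexive inner inverse of `a ^ 2` modulo the kernel.
  set r := r₀ * (a * a) * r₀ with hr
  set x := a * r * a with hx
  -- `x` is idempotent modulo the kernel, and `a (1 - x) a` lies in the kernel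
  have hrr : f r * f a * f a * f r = f r := by
    have : f r * f a * f a * f r
        = f r₀ * (f a * f a * f r₀ * (f a * f a)) * f r₀ * (f a * f a) * f r₀ := by
      simp only [hr, map_mul]; noncomm_ring
    have h' : f r₀ * (f a * f a) * f r₀ * (f a * f a) * f r₀
        = f r₀ * (f a * f a * f r₀ * (f a * f a)) * f r₀ := by noncomm_ring
    rw [this, ht, h', ht, hr, map_mul, map_mul, map_mul]
  have hfx : f x * f x = f x := by
    calc f x * f x = f a * (f r * f a * f a * f r) * f a := by
          simp only [hx, map_mul, mul_assoc]
      _ = f x := by rw [hrr]; simp only [hx, map_mul]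
  have hfa : f a * f x * f a = f a * f a := by
    calc f a * f x * f a = f a * f a * f r₀ * (f a * f a) * f r₀ * (f a * f a) := by
          simp only [hx, hr, map_mul, mul_assoc]
      _ = f a * f a := by rw [ht, ht]
  have hker2 : (x * x - x) * (x * x - x) = 0 := by
    apply hker <;> rw [map_sub, map_mul, hfx, sub_self]
  -- The Newton step for the equation `x ^ 2 = x`, which stays inside `a R a`.
  set e := 3 * (x * x) - 2 * (x * x * x) with he
  have hfe : f e = f x := by
    rw [he, map_sub, map_mul _ 3, map_mul _ 2, map_mul _ (x * x), map_mul _ x x, hfx, hfx,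
      ← sub_mul, map_ofNat, map_ofNat]
    norm_num
  refine ⟨e, ⟨3 * (r * a * a * r) - 2 * (r * a * a * r * a * a * r), ?_⟩, ?_, ?_⟩
  · simp only [he, hx]
    noncomm_ring
  · have : e * e - e = (x * x - x) * (x * x - x) * (4 * (x * x) - 4 * x - 3) := by
      simp only [he]
      noncomm_ring
    rw [IsIdempotentElem, ← sub_eq_zero, this, hker2, zero_mul]
  · have h0 : f ((a * (1 - e)) ^ 2) = 0 := by
      rw [pow_two, ← mul_assoc, map_mul _ _ (1 - e), map_mul, map_mul, map_sub, map_one, hfe,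
        mul_sub (f a), sub_mul, mul_one, hfa, sub_self, zero_mul]
    rw [show 4 = 2 + 2 from rfl, pow_add]
    exact hker _ _ h0 h0

/-! ### A matrix over `ℤ/4` with a non-regular power -/

/-- The lower shift of size `m + 1` over `ℤ/4` whose first weight is 2 and whose other weights
are 1. -/
def weightedShift (m : ℕ) : Matrix (Fin (m + 1)) (Fin (m + 1)) (ZMod 4) :=
  Matrix.of fun i j => if (i : ℕ) = j + 1 then if (j : ℕ) = 0 then 2 else 1 else 0

theorem weightedShift_pow_apply (m k : ℕ) (i j : Fin (m + 1)) :
    (weightedShift m ^ (k + 1)) i j =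
      if (i : ℕ) = j + (k + 1) then if (j : ℕ) = 0 then 2 else 1 else 0 := by
  induction k generalizing i with
  | zero => simp [weightedShift]
  | succ k ih =>
    rw [pow_succ', Matrix.mul_apply]
    simp only [ih]
    by_cases h : (j : ℕ) + (k + 1) < m + 1
    · rw [Finset.sum_eq_single ⟨j + (k + 1), h⟩]
      · simp only [weightedShift, Matrix.of_apply, if_true]
        simp [add_assoc]
        split_ifs <;> rfl
      · intro l _ hl
        rw [if_neg fun h' => hl (Fin.ext h'), mul_zero]
      · simp
    · rw [Finset.sum_eq_zero, if_neg (by omega)]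
      intro l _
      rw [if_neg (by omega), mul_zero]

/-- The only nonzero entry of `weightedShift m ^ m` is 2, in the lower left corner. -/
theorem weightedShift_pow_ne (m : ℕ) (hm : m ≠ 0)
    (B : Matrix (Fin (m + 1)) (Fin (m + 1)) (ZMod 4)) :
    weightedShift m ^ m ≠ weightedShift m ^ m * B * weightedShift m ^ m := by
  intro h
  obtain ⟨k, rfl⟩ := Nat.exists_eq_succ_of_ne_zero hm
  have hs : ∀ i j, (weightedShift (k + 1) ^ (k + 1)) i j =
      if i = Fin.last (k + 1) ∧ j = 0 then 2 else 0 := by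
    intro i j
    rw [weightedShift_pow_apply]
    have : (i : ℕ) = j + (k + 1) ↔ i = Fin.last (k + 1) ∧ j = 0 := by
      have hi := i.2
      have hj : j = 0 ↔ (j : ℕ) = 0 := by rw [Fin.ext_iff, Fin.val_zero]
      rw [hj, Fin.ext_iff, Fin.val_last]
      omega
    rw [if_congr this rfl rfl]
    by_cases hij : i = Fin.last (k + 1) ∧ j = 0
    · rw [if_pos hij, if_pos hij, hij.2, Fin.val_zero, if_pos rfl]
    · rw [if_neg hij, if_neg hij]
  have h0 : (2 : ZMod 4) = 2 * B 0 (Fin.last (k + 1)) * 2 := by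
    have h1 := congrFun (congrFun h (Fin.last (k + 1))) 0
    rwa [Matrix.mul_apply, Finset.sum_eq_single (Fin.last (k + 1)), Matrix.mul_apply,
      Finset.sum_eq_single 0, hs, if_pos ⟨rfl, rfl⟩] at h1
    · intro j _ hj
      rw [hs, if_neg fun h' => hj h'.2, zero_mul]
    · simp
    · intro j _ hj
      rw [hs, if_neg fun h' => hj h'.1, mul_zero]
    · simp
  have : ∀ c : ZMod 4, (2 : ZMod 4) ≠ 2 * c * 2 := by decide
  exact this _ h0

/-! ### The product of matrix rings over `ℤ/4` -/

/-- Entrywise reduction modulo 2. -/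
def reductionModTwo : ProdMatrixZModFour →+*
    ∀ n : ℕ+, Matrix (Fin (n : ℕ)) (Fin (n : ℕ)) (ZMod 2) :=
  RingHom.pi fun n => ((ZMod.castHom (by norm_num : 2 ∣ 4) (ZMod 2)).mapMatrix).comp
    (Pi.evalRingHom _ n)

theorem reductionModTwo_apply (a : ProdMatrixZModFour) (n : ℕ+) (i j : Fin (n : ℕ)) :
    reductionModTwo a n i j = ZMod.castHom (by norm_num : 2 ∣ 4) (ZMod 2) (a n i j) := rfl

theorem reductionModTwo_surjective : Function.Surjective reductionModTwo := by
  intro b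
  choose g hg using ZMod.castHom_surjective (by norm_num : 2 ∣ 4)
  exact ⟨fun n => Matrix.of fun i j => g (b n i j), by
    funext n; ext i j; rw [reductionModTwo_apply]; exact hg _⟩

theorem mul_eq_zero_of_reductionModTwo (x y : ProdMatrixZModFour) (hx : reductionModTwo x = 0)
    (hy : reductionModTwo y = 0) : x * y = 0 := by
  have key : ∀ c c' : ZMod 4, ZMod.castHom (by norm_num : 2 ∣ 4) (ZMod 2) c = 0 →
    ZMod.castHom (by norm_num : 2 ∣ 4) (ZMod 2) c' = 0 → c * c' = 0 := by decide
  funext n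
  ext i j
  rw [Pi.mul_apply, Matrix.mul_apply]
  refine Finset.sum_eq_zero fun l _ => key _ _ ?_ ?_
  · rw [← reductionModTwo_apply, hx]; rfl
  · rw [← reductionModTwo_apply, hy]; rfl

theorem mainTheorem4 :
    IsDRegularlyNilClean ProdMatrixZModFour ∧
    IsDRegularlyNilCleanOfIndexAtMost ProdMatrixZModFour 4 ∧
    IsNilCleanRing ProdMatrixZModFour ∧
    IsStronglyCleanRing ProdMatrixZModFour ∧
    ¬ IsPiRegularRing ProdMatrixZModFour := by
  have hreg : ∀ s : ∀ n : ℕ+, Matrix (Fin (n : ℕ)) (Fin (n : ℕ)) (ZMod 2), ∃ t, s * t * s = s := by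
    intro s
    choose t ht using fun n => Matrix.exists_mul_mul_eq_self (s n)
    exact ⟨t, funext ht⟩
  have hD := exists_isIdempotentElem_mul_one_sub_pow_four_eq_zero reductionModTwo_surjective
    mul_eq_zero_of_reductionModTwo hreg
  refine ⟨fun a => ?_, ⟨by norm_num, hD⟩, fun a => ?_, fun a => ?_, fun h => ?_⟩
  · obtain ⟨e, he, hi, h4⟩ := hD a
    exact ⟨e, he, hi, 4, h4⟩
  · obtain ⟨e, q, he, hq, ha⟩ := HasNilCleanDecomposition.of_map reductionModTwo_surjective
      mul_eq_zero_of_reductionModTwo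
      (HasNilCleanDecomposition.pi fun n => Matrix.hasNilCleanDecomposition (reductionModTwo a n))
    exact ⟨q, e, ⟨_, hq⟩, he, by rw [ha, add_comm]⟩
  · choose u e hu he ha hc using fun n => Finite.exists_isUnit_add_isIdempotentElem (a n)
    exact ⟨u, e, Pi.isUnit_iff.2 hu, funext he, funext ha, funext hc⟩
  · -- The power `m` fails to be regular in the factor of size `m + 1`. The factor `n` carries the
    -- shift of size `n.natPred + 1`, which equals `n` only propositionally.
    obtain ⟨m, hm, b, hb⟩ := h fun n => (weightedShift (n.natPred)).submatrix
      (Fin.cast n.natPred_add_one.symm) (Fin.cast n.natPred_add_one.symm)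
    have := congrFun hb m.succPNat
    exact weightedShift_pow_ne m (by omega) (b m.succPNat) this
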